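/- Let $\mathbb T=\mathbb R/\mathbb Z$ be the circle with Lebesgue measure $|\cdot|$. A weight is a measurable function $w:\mathbb T\to\mathbb R$ that is positive almost everywhere. For $1<p<\infty$ a weight $w$ satisfies $A_p$ if $$\sup_I\Big(\frac1{|I|}\int_I w\Big)\Big(\frac1{|I|}\int_I w^{-\frac1{p-1}}\Big)^{p-1}<\infty,$$ where $I$ runs over all arcs of $\mathbb T$; it satisfies $A_1$ if $Mw\le Cw$ almost everywhere for some constant $C$, where $M$ is the Hardy–Littlewood maximal operator; and it satisfies $A_\infty$ if it satisfies $A_p$ for some $p\in[1,\infty)$. For $1<p<2$ a weight $w$ satisfies $\alpha_p$ if $$\sup_I\Big(\frac1{|I|}\int_I w^{-\frac1{p-1}}\Big)^{p-1}\Big(\frac1{|I|}\int_I w^{\frac2{2-p}}\Big)^{\frac{2-p}2}<\infty,$$ and it satisfies $\alpha_1$ if $w^2\in A_1$. Let $1\le q<2$, let $w$ be a weight satisfying $\alpha_q$, and let $a$ be a weight satisfying $A_\infty$. Then there is $\delta\in(0,1)$ such that for every $t\in[1-\delta,1)$ there is $r\in(1,2)$ for which the weight $w^ta^{1-t}$ satisfies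 $\alpha_r$. Moreover, if $q>1$, then $\delta$ can be chosen so that, in addition, for every $t\in[1-\delta,1)$ one has $tq\in(1,2)$ and $w^ta^{1-t}$ satisfies $\alpha_{tq}$. -/

import Mathlib

open MeasureTheory Set
open scoped ENNReal NNReal

/-- A weight on the circle `ℝ / ℤ`: a measurable function that is finite and strictly positive
almost everywhere. -/
def IsWeight (w : UnitAddCircle → ℝ) : Prop :=
  AEMeasurable w volume ∧ ∀ᵐ x, 0 < w x

/-- The arcs of the circle: images of the segments `[x, x + ℓ]` with `0 < ℓ ≤ 1`
(endpoints have measure zero, so they do not influence averages). -/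
def circleArcs : Set (Set UnitAddCircle) :=
  {I | ∃ x ℓ : ℝ, 0 < ℓ ∧ ℓ ≤ 1 ∧ I = (fun s : ℝ => (s : UnitAddCircle)) '' Icc x (x + ℓ)}

/-- The average over `I` of the function `f ^ s`, where `f` is nonnegative;
it takes the value `∞` if `f ^ s` is not integrable over `I`. -/
noncomputable def powAvg (I : Set UnitAddCircle) (f : UnitAddCircle → ℝ) (s : ℝ) : ℝ≥0∞ :=
  ⨍⁻ x in I, ENNReal.ofReal (f x ^ s) ∂volume

/-- The (uncentered) Hardy-Littlewood maximal function. -/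
noncomputable def hlMaximal (f : UnitAddCircle → ℝ) (x : UnitAddCircle) : ℝ≥0∞ :=
  ⨆ I ∈ {I | I ∈ circleArcs ∧ x ∈ I}, ⨍⁻ y in I, ENNReal.ofReal |f y| ∂volume

/-- The Muckenhoupt condition `A_p`, for `1 ≤ p < ∞`. -/
def MuckenhouptA (p : ℝ) (w : UnitAddCircle → ℝ) : Prop :=
  IsWeight w ∧
    if p = 1 then
      ∃ C : ℝ≥0, ∀ᵐ x, hlMaximal w x ≤ C * ENNReal.ofReal (w x)
    else
      (⨆ I ∈ circleArcs, powAvg I w 1 * powAvg I w (-(1 / (p - 1))) ^ (p - 1)) < ∞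

/-- The condition `A_∞`: the weight satisfies `A_p` for some finite `p`. -/
def MuckenhouptAInfty (w : UnitAddCircle → ℝ) : Prop :=
  ∃ p : ℝ, 1 ≤ p ∧ MuckenhouptA p w

/-- The condition `α_p`, for `1 ≤ p ≤ 2`. -/
def AlphaCondition (p : ℝ) (w : UnitAddCircle → ℝ) : Prop :=
  IsWeight w ∧
    if p = 1 then
      MuckenhouptA 1 (fun x => w x ^ 2)
    else if p = 2 then
      MuckenhouptA 1 (fun x => (w x)⁻¹)
    else
      (⨆ I ∈ circleArcs,
        powAvg I w (-(1 / (p - 1))) ^ (p - 1) * powAvg I w (2 / (2 - p)) ^ ((2 - p) / 2)) < ∞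

/-! For `1 < q < 2` put `σ = w ^ (-1/(q-1))`. The `α_q` product raised to the power `1/(q-1)` is
exactly a Muckenhoupt product for `σ`, so `σ` satisfies a reverse Hölder inequality: averages of `σ
^ (1+ε)` are controlled by those of `σ`.

In the `α_{tq}` product of `w^t a^(1-t)`, the positive-power average splits by Hölder into averages
of `w ^ (2/(2-q))` and `a`, with exponents adding up to exactly 1. The negative-power average
involves `w ^ (-t/(tq-1))`, and `t/(tq-1) > 1/(q-1)` for `t < 1`, so more integrability than `α_q`
offers is needed. The gain `ε` provides it once `t` is near 1, with room left for the dual average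
from the `A_s` condition of `a`. The result is bounded by the `α_q` constant to the power `t` times
the `A_s` constant to the power `1-t`, up to a constant. For `q = 1`, reverse Hölder for the `A_1`
weight `w^2` first yields `α_r` with some `r > 1`.

Reverse Hölder itself is proved on intervals. Hölder turns the Muckenhoupt condition into a
quantitative doubling property (`lintegral_mul_volume_rpow_le`); a continuous stopping argument and
Vitali's covering lemma give a level set inequality (`lintegral_level_set_le`); integrating it over
levels and absorbing gives higher integrability (`lintegral_rpow_le_of_level_set_le`). -/

/-! ### Higher integrability from a level set inequality -/

/-- Truncated form of Gehring's argument: a level set inequality gives higher integrability. -/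
theorem lintegral_min_rpow_le_of_level_set_le {α : Type*} [MeasurableSpace α] {μ : Measure α}
    {U : α → ℝ} (hU : Measurable U) (hpos : ∀ x, 0 < U x)
    (hfin : ∫⁻ x, ENNReal.ofReal (U x) ∂μ ≠ ∞) {A c L ε N : ℝ} (hA : 0 ≤ A) (hc : 0 < c)
    (hc1 : c ≤ 1) (hL : 0 < L) (hN : 0 < N) (hε : 0 < ε) (hεA : ε * A * (c ^ (1 + ε))⁻¹ ≤ 1 / 2)
    (H : ∀ t, L ≤ t → ∫⁻ x in {x | t < U x}, ENNReal.ofReal (U x) ∂μ ≤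
      ENNReal.ofReal (A * t) * μ {x | c * t < U x}) :
    ∫⁻ x, ENNReal.ofReal (U x) * ENNReal.ofReal (min (U x) N ^ ε) ∂μ ≤
      2 * (ENNReal.ofReal (L ^ ε) * ∫⁻ x, ENNReal.ofReal (U x) ∂μ) := by
  set ν := μ.withDensity (fun x => ENNReal.ofReal (U x)) with hν
  have hUm : Measurable (fun x => ENNReal.ofReal (U x)) := hU.ennreal_ofReal
  -- The truncation at `N` keeps the left side finite, so that half of it can be absorbed at the
  -- end.
  set g : α → ℝ := fun x => min (U x) N with hg
  have hgm : Measurable g := hU.min measurable_const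
  have hg0 : ∀ x, 0 < g x := fun x => lt_min (hpos x) hN
  have hνint : ∀ f : α → ℝ≥0∞, Measurable f →
      ∫⁻ x, f x ∂ν = ∫⁻ x, ENNReal.ofReal (U x) * f x ∂μ := fun f hf => by
    rw [hν, lintegral_withDensity_eq_lintegral_mul _ hUm hf]; rfl
  have hνuniv : ν univ = ∫⁻ x, ENNReal.ofReal (U x) ∂μ := by
    rw [hν, withDensity_apply _ MeasurableSet.univ, Measure.restrict_univ]
  -- Layer-cake integrands are compared: levels below `L` are kept, levels between `L` and `N` are
  -- handled by `H`, and levels from `N` on are empty.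
  have key : ∀ t ∈ Ioi (0 : ℝ), ν {x | t < g x} * ENNReal.ofReal (t ^ (ε - 1)) ≤
      ν {x | t < min (g x) L} * ENNReal.ofReal (t ^ (ε - 1)) +
        ENNReal.ofReal A * (μ {x | t < g x / c} * ENNReal.ofReal (t ^ ((1 + ε) - 1))) := by
    intro t ht
    have ht : 0 < t := ht
    rcases lt_or_ge t L with htL | htL
    · have : {x | t < min (g x) L} = {x | t < g x} := by
        ext x; simp [htL]
      rw [this]; exact le_self_add
    · refine le_trans ?_ le_add_self
      have h1 : ν {x | t < g x} ≤ ENNReal.ofReal (A * t) * μ {x | t < g x / c} := by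
        rcases lt_or_ge t N with htN | htN
        · have e1 : {x | t < g x} = {x | t < U x} := by ext x; simp [hg, htN]
          have e2 : {x | c * t < U x} ⊆ {x | t < g x / c} := by
            intro x hx
            have hx : c * t < U x := hx
            simp only [mem_ofPred_eq, lt_div_iff₀ hc, hg, lt_min_iff]
            constructor <;> nlinarith
          rw [e1, hν, withDensity_apply _ (measurableSet_lt measurable_const hU)]
          exact (H t htL).trans (by gcongr)
        · have : {x | t < g x} = ∅ := by
            ext x; simp [hg, htN]
          rw [this]; simp
      calc _ ≤ ENNReal.ofReal (A * t) * μ {x | t < g x / c} * ENNReal.ofReal (t ^ (ε - 1)) := by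
            gcongr
        _ = ENNReal.ofReal A * (μ {x | t < g x / c} *
              (ENNReal.ofReal t * ENNReal.ofReal (t ^ (ε - 1)))) := by
            rw [ENNReal.ofReal_mul hA]; ring
        _ = _ := by
            rw [← ENNReal.ofReal_mul ht.le]
            congr 4
            rw [show 1 + ε - 1 = 1 + (ε - 1) by ring, Real.rpow_add ht, Real.rpow_one]
  have m1 : Measurable (fun t : ℝ => ν {x | t < min (g x) L} * ENNReal.ofReal (t ^ (ε - 1))) := by
    refine Measurable.mul ?_ (by fun_prop)
    exact Antitone.measurable fun s t hst => measure_mono fun x hx => lt_of_le_of_lt hst hx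
  have l1 := lintegral_rpow_eq_lintegral_meas_lt_mul ν
    (f := g) (.of_forall fun x => (hg0 x).le) hgm.aemeasurable hε
  have l2 := lintegral_rpow_eq_lintegral_meas_lt_mul ν
    (f := fun x => min (g x) L) (.of_forall fun x => (lt_min (hg0 x) hL).le)
    (hgm.min measurable_const).aemeasurable hε
  have l3 := lintegral_rpow_eq_lintegral_meas_lt_mul μ
    (f := fun x => g x / c) (.of_forall fun x => (div_pos (hg0 x) hc).le)
    (hgm.div_const c).aemeasurable (show 0 < 1 + ε by linarith)
  have hX : ∫⁻ x, ENNReal.ofReal (g x ^ ε) ∂ν ≤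
      ENNReal.ofReal (L ^ ε) * ν univ + ENNReal.ofReal (1 / 2) *
        ∫⁻ x, ENNReal.ofReal (g x ^ ε) ∂ν := by
    calc ∫⁻ x, ENNReal.ofReal (g x ^ ε) ∂ν
        ≤ ENNReal.ofReal ε * ∫⁻ t in Ioi 0, (ν {x | t < min (g x) L} * ENNReal.ofReal (t ^ (ε - 1))
            + ENNReal.ofReal A * (μ {x | t < g x / c} * ENNReal.ofReal (t ^ ((1 + ε) - 1)))) := by
          rw [l1]
          gcongr 1
          exact setLIntegral_mono' measurableSet_Ioi key
      _ = ∫⁻ x, ENNReal.ofReal (min (g x) L ^ ε) ∂ν + ENNReal.ofReal ε * (ENNReal.ofReal A *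
            ∫⁻ t in Ioi 0, (μ {x | t < g x / c} * ENNReal.ofReal (t ^ ((1 + ε) - 1)))) := by
          rw [lintegral_add_left m1, mul_add, l2, lintegral_const_mul' _ _ ENNReal.ofReal_ne_top]
      _ ≤ ∫⁻ x, ENNReal.ofReal (L ^ ε) ∂ν + ENNReal.ofReal ε * (ENNReal.ofReal A *
            ∫⁻ x, ENNReal.ofReal ((g x / c) ^ (1 + ε)) ∂μ) := by
          gcongr ?_ + _ * (_ * ?_)
          · refine lintegral_mono fun x => ENNReal.ofReal_le_ofReal ?_
            exact Real.rpow_le_rpow (lt_min (hg0 x) hL).le (min_le_right _ _) hε.le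
          · rw [l3]
            -- The layer-cake formula for exponent `1 + ε` carries a factor `1 + ε ≥ 1`, which may
            -- be dropped.
            refine le_mul_of_one_le_left zero_le ?_
            rw [ENNReal.one_le_ofReal]; linarith
      _ ≤ _ := by
          rw [lintegral_const]
          gcongr _ + ?_
          rw [hνint _ (by fun_prop), ← lintegral_const_mul' _ _ ENNReal.ofReal_ne_top,
            ← lintegral_const_mul' _ _ ENNReal.ofReal_ne_top,
            ← lintegral_const_mul' _ _ ENNReal.ofReal_ne_top]
          refine lintegral_mono fun x => ?_
          dsimp only
          rw [← ENNReal.ofReal_mul hA, ← ENNReal.ofReal_mul hε.le, ← ENNReal.ofReal_mul (hpos x).le,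
            ← ENNReal.ofReal_mul (by norm_num)]
          refine ENNReal.ofReal_le_ofReal ?_
          rw [Real.div_rpow (hg0 x).le hc.le]
          have e : g x ^ (1 + ε) ≤ U x * g x ^ ε := by
            rw [Real.rpow_add (hg0 x), Real.rpow_one]
            have := min_le_left (U x) N
            have h3 : 0 < g x ^ ε := Real.rpow_pos_of_pos (hg0 x) _
            gcongr
          calc ε * (A * (g x ^ (1 + ε) / c ^ (1 + ε)))
              = (ε * A * (c ^ (1 + ε))⁻¹) * g x ^ (1 + ε) := by ring
            _ ≤ 1 / 2 * (U x * g x ^ ε) := by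
              have := Real.rpow_pos_of_pos (hg0 x) (1 + ε)
              gcongr
  have hXfin : ∫⁻ x, ENNReal.ofReal (g x ^ ε) ∂ν ≠ ∞ := by
    refine ne_top_of_le_ne_top (b := ENNReal.ofReal (N ^ ε) * ν univ) ?_ ?_
    · rw [hνuniv]; exact ENNReal.mul_ne_top ENNReal.ofReal_ne_top hfin
    · rw [← lintegral_const]
      refine lintegral_mono fun x => ENNReal.ofReal_le_ofReal ?_
      exact Real.rpow_le_rpow (hg0 x).le (min_le_right _ _) hε.le
  rw [← hνint (fun x => ENNReal.ofReal (g x ^ ε)) (by fun_prop), ← hνuniv]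
  have hYfin : ENNReal.ofReal (L ^ ε) * ν univ ≠ ∞ := by
    rw [hνuniv]; exact ENNReal.mul_ne_top ENNReal.ofReal_ne_top hfin
  generalize (∫⁻ x, ENNReal.ofReal (g x ^ ε) ∂ν) = X at hX hXfin ⊢
  generalize ENNReal.ofReal (L ^ ε) * ν univ = Y at hX hYfin ⊢
  lift X to ℝ≥0 using hXfin
  lift Y to ℝ≥0 using hYfin
  have : ENNReal.ofReal (1 / 2) = ((1 / 2 : ℝ≥0) : ℝ≥0∞) := by
    rw [ENNReal.ofReal]; congr 1; ext; simp
  rw [this] at hX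
  norm_cast at hX ⊢
  have hX' : (X : ℝ) ≤ Y + (1 / 2) * X := by exact_mod_cast hX
  have : (X : ℝ) ≤ 2 * Y := by linarith
  exact_mod_cast this

/-- Gehring's argument: a level set inequality gives higher integrability. -/
theorem lintegral_rpow_le_of_level_set_le {α : Type*} [MeasurableSpace α] {μ : Measure α}
    {U : α → ℝ} (hU : Measurable U) (hpos : ∀ x, 0 < U x)
    (hfin : ∫⁻ x, ENNReal.ofReal (U x) ∂μ ≠ ∞) {A c L ε : ℝ} (hA : 0 ≤ A) (hc : 0 < c)
    (hc1 : c ≤ 1) (hL : 0 < L) (hε : 0 < ε) (hεA : ε * A * (c ^ (1 + ε))⁻¹ ≤ 1 / 2)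
    (H : ∀ t, L ≤ t → ∫⁻ x in {x | t < U x}, ENNReal.ofReal (U x) ∂μ ≤
      ENNReal.ofReal (A * t) * μ {x | c * t < U x}) :
    ∫⁻ x, ENNReal.ofReal (U x ^ (1 + ε)) ∂μ ≤
      2 * (ENNReal.ofReal (L ^ ε) * ∫⁻ x, ENNReal.ofReal (U x) ∂μ) := by
  have e : ∀ x, ENNReal.ofReal (U x ^ (1 + ε)) =
      ⨆ n : ℕ, ENNReal.ofReal (U x) * ENNReal.ofReal (min (U x) (n + 1) ^ ε) := by
    intro x
    apply le_antisymm
    · obtain ⟨n, hn⟩ := exists_nat_ge (U x)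
      refine le_trans ?_ (le_iSup _ n)
      rw [min_eq_left (by linarith), ← ENNReal.ofReal_mul (hpos x).le, Real.rpow_add (hpos x),
        Real.rpow_one]
    · refine iSup_le fun n => ?_
      rw [← ENNReal.ofReal_mul (hpos x).le, Real.rpow_add (hpos x), Real.rpow_one]
      refine ENNReal.ofReal_le_ofReal ?_
      have h1 : 0 ≤ min (U x) ((n : ℝ) + 1) := le_min (hpos x).le (by positivity)
      have := hpos x
      gcongr
      exact min_le_left _ _
  simp_rw [e]
  rw [lintegral_iSup]
  · exact iSup_le fun n => lintegral_min_rpow_le_of_level_set_le hU hpos hfin hA hc hc1 hL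
      (by positivity) hε hεA H
  · intro n; fun_prop
  · intro m n hmn x
    have h1 : 0 ≤ min (U x) ((m : ℝ) + 1) := le_min (hpos x).le (by positivity)
    dsimp only
    gcongr

/-! ### Stopping intervals and the level set inequality on the line -/

/-- Almost every point of a high level set lies in an interval where the average equals the level. -/
theorem ae_exists_interval_integral_eq {U : ℝ → ℝ} {a b t : ℝ} (hab : a < b)
    (hU : IntegrableOn U (Icc a b)) (ht : ∫ x in a..b, U x < t * (b - a)) :
    ∀ᵐ x, x ∈ Icc a b → t < U x → ∃ c d, a ≤ c ∧ c < d ∧ d ≤ b ∧ x ∈ Icc c d ∧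
      ∫ y in c..d, U y = t * (d - c) := by
  have hUi : IntervalIntegrable U volume a b := by
    rw [intervalIntegrable_iff_integrableOn_Icc_of_le hab.le]; exact hU
  have hends : ∀ᵐ x : ℝ, x ≠ a ∧ x ≠ b := by
    rw [Filter.eventually_and]
    exact ⟨Measure.ae_ne volume a, Measure.ae_ne volume b⟩
  filter_upwards [hUi.ae_hasDerivAt_integral, hends] with x hx hne hxI htx
  have hxa : a < x := lt_of_le_of_ne hxI.1 (Ne.symm hne.1)
  have hxb : x < b := lt_of_le_of_ne hxI.2 hne.2
  have hx := hx (by rw [uIcc_of_le hab.le]; exact hxI) a (by simp)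
  set F : ℝ → ℝ := fun z => ∫ y in a..z, U y with hF
  have hFc : ContinuousOn F (Icc a b) := by
    have := intervalIntegral.continuousOn_primitive_interval (μ := volume) (f := U) (a := a) (b := b)
      (by rw [uIcc_of_le hab.le]; exact hU)
    rwa [uIcc_of_le hab.le] at this
  -- As `s` runs from 0 to 1 the interval grows linearly from `{x}` to `[a, b]`, with length `s * (b
  -- - a)`; `φ` is the integral minus `t` times the length. It starts at 0 with slope `(U x - t) *
  -- (b - a) > 0` (Lebesgue differentiation) and ends negative, so it vanishes in between.
  set φ : ℝ → ℝ := fun s => F (x + s * (b - x)) - F (x - s * (x - a)) - t * (s * (b - a)) with hφ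
  have hmem : ∀ s ∈ Icc (0 : ℝ) 1, x + s * (b - x) ∈ Icc a b ∧ x - s * (x - a) ∈ Icc a b := by
    rintro s ⟨h0, h1⟩
    refine ⟨⟨?_, ?_⟩, ⟨?_, ?_⟩⟩ <;> nlinarith
  have hφc : ContinuousOn φ (Icc 0 1) := by
    refine ((hFc.comp (by fun_prop) fun s hs => (hmem s hs).1).sub
      (hFc.comp (by fun_prop) fun s hs => (hmem s hs).2)).sub (by fun_prop)
  have hφ1 : φ 1 < 0 := by
    simp only [hφ, hF, one_mul, add_sub_cancel, sub_sub_cancel, intervalIntegral.integral_same]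
    linarith
  have hφd : HasDerivAt φ (U x * (b - x) - U x * (-(x - a)) - t * (b - a)) 0 := by
    have i1 : HasDerivAt (fun s : ℝ => x + s * (b - x)) (b - x) 0 := by
      simpa using ((hasDerivAt_id (0 : ℝ)).mul_const (b - x)).const_add x
    have i2 : HasDerivAt (fun s : ℝ => x - s * (x - a)) (-(x - a)) 0 := by
      simpa using ((hasDerivAt_id (0 : ℝ)).mul_const (x - a)).const_sub x
    have i3 : HasDerivAt (fun s : ℝ => t * (s * (b - a))) (t * (b - a)) 0 := by
      simpa using ((hasDerivAt_id (0 : ℝ)).mul_const (b - a)).const_mul t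
    have j1 : HasDerivAt (fun s : ℝ => F (x + s * (b - x))) (U x * (b - x)) 0 :=
      HasDerivAt.comp (h₂ := F) 0 (by simpa using hx) i1
    have j2 : HasDerivAt (fun s : ℝ => F (x - s * (x - a))) (U x * (-(x - a))) 0 :=
      HasDerivAt.comp (h₂ := F) 0 (by simpa using hx) i2
    exact (j1.sub j2).sub i3
  have hdpos : 0 < U x * (b - x) - U x * (-(x - a)) - t * (b - a) := by nlinarith
  obtain ⟨s, hs0, hs1, hs⟩ : ∃ s, 0 < s ∧ s < 1 ∧ 0 < φ s := by
    have h0 : φ 0 = 0 := by simp [hφ]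
    have := (hasDerivAt_iff_tendsto_slope.1 hφd).eventually (lt_mem_nhds hdpos)
    have h2 : ∀ᶠ s in nhdsWithin (0 : ℝ) (Ioi 0), 0 < slope φ 0 s :=
      this.filter_mono (nhdsWithin_mono _ fun s hs => ne_of_gt hs)
    obtain ⟨s, hs, hs'⟩ := (h2.and (Ioo_mem_nhdsGT (show (0 : ℝ) < 1 by norm_num))).exists
    refine ⟨s, hs'.1, hs'.2, ?_⟩
    rw [slope_def_field, h0, sub_zero, sub_zero] at hs
    exact (div_pos_iff_of_pos_right hs'.1).1 hs
  obtain ⟨z, hz, hzφ⟩ : (0 : ℝ) ∈ φ '' Icc s 1 :=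
    intermediate_value_Icc' hs1.le (hφc.mono (Icc_subset_Icc_left hs0.le)) ⟨hφ1.le, hs.le⟩
  have hz0 : 0 < z := hs0.trans_le hz.1
  obtain ⟨hd, hc⟩ := hmem z ⟨hz0.le, hz.2⟩
  refine ⟨x - z * (x - a), x + z * (b - x), hc.1, by nlinarith, hd.2,
    ⟨by nlinarith, by nlinarith⟩, ?_⟩
  have hii : ∀ y ∈ Icc a b, IntervalIntegrable U volume a y := fun y hy =>
    hUi.mono_set (by rw [uIcc_of_le hab.le, uIcc_of_le hy.1]; exact Icc_subset_Icc_right hy.2)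
  rw [← intervalIntegral.integral_interval_sub_left (hii _ hd) (hii _ hc)]
  have : φ z = 0 := hzφ
  simp only [hφ, hF] at this
  linarith

theorem ofReal_half_le_of_le_add {x : ℝ} (hx : 0 ≤ x) {v e : ℝ≥0∞} (h : ENNReal.ofReal x ≤ e + v)
    (he : e ≤ ENNReal.ofReal (x / 2)) : ENNReal.ofReal (x / 2) ≤ v := by
  have h1 : ENNReal.ofReal (x / 2) + ENNReal.ofReal (x / 2) ≤ ENNReal.ofReal (x / 2) + v := by
    rw [← ENNReal.ofReal_add (by positivity) (by positivity), add_halves]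
    exact h.trans (by gcongr)
  exact (ENNReal.add_le_add_iff_left ENNReal.ofReal_ne_top).1 h1

/-- On an interval where the average of `U` is `t`, the function `U` exceeds a fixed multiple of `t`
on at least half of the interval. -/
theorem half_length_le_volume_level_set {U : ℝ → ℝ} (hU : Measurable U) {c d p K t : ℝ}
    (hcd : c < d) (hp : 0 < p) (hK : 1 ≤ K) (ht0 : 0 < t)
    (hD : ∀ E ⊆ Icc c d, MeasurableSet E →
      (∫⁻ x in Icc c d, ENNReal.ofReal (U x)) * volume E ^ p ≤
        ENNReal.ofReal K * (∫⁻ x in E, ENNReal.ofReal (U x)) * ENNReal.ofReal (d - c) ^ p)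
    (hJ : ∫⁻ x in Icc c d, ENNReal.ofReal (U x) = ENNReal.ofReal (t * (d - c))) :
    ENNReal.ofReal ((d - c) / 2) ≤ volume (Icc c d ∩ {x | (2 ^ p * K)⁻¹ * t < U x}) := by
  have hdc : 0 < d - c := sub_pos.2 hcd
  set κ := (2 ^ p * K)⁻¹ with hκ
  have h2p : (0 : ℝ) < 2 ^ p := by positivity
  have hκ0 : 0 < κ := by positivity
  -- The constant `κ` is such that doubling applied to this low set forces its measure to be at most
  -- half the length.
  set E := Icc c d ∩ {x | U x ≤ κ * t} with hE
  have hEm : MeasurableSet E := measurableSet_Icc.inter (measurableSet_le hU measurable_const)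
  have hvE : volume E ≤ ENNReal.ofReal (d - c) := by
    rw [← Real.volume_Icc]; exact measure_mono inter_subset_left
  have huE : ∫⁻ x in E, ENNReal.ofReal (U x) ≤ ENNReal.ofReal (κ * t * (d - c)) := by
    calc ∫⁻ x in E, ENNReal.ofReal (U x) ≤ ∫⁻ x in E, ENNReal.ofReal (κ * t) :=
          setLIntegral_mono' hEm fun x hx => ENNReal.ofReal_le_ofReal hx.2
      _ = ENNReal.ofReal (κ * t) * volume E := by rw [setLIntegral_const]
      _ ≤ _ := by
        rw [ENNReal.ofReal_mul (by positivity : 0 ≤ κ * t)]; gcongr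
  have h1 := hD E inter_subset_left hEm
  rw [hJ] at h1
  have h2 : ENNReal.ofReal (t * (d - c)) * volume E ^ p ≤
      ENNReal.ofReal (t * (d - c)) * ENNReal.ofReal ((d - c) / 2) ^ p := by
    refine h1.trans ((by gcongr : _ ≤ ENNReal.ofReal K * ENNReal.ofReal (κ * t * (d - c)) *
      ENNReal.ofReal (d - c) ^ p).trans (le_of_eq ?_))
    rw [ENNReal.ofReal_rpow_of_pos hdc, ENNReal.ofReal_rpow_of_pos (by positivity),
      ← ENNReal.ofReal_mul (by positivity), ← ENNReal.ofReal_mul (by positivity),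
      ← ENNReal.ofReal_mul (by positivity), Real.div_rpow hdc.le (by norm_num), hκ]
    congr 1
    field_simp
  have h3 : volume E ≤ ENNReal.ofReal ((d - c) / 2) := by
    rw [ENNReal.mul_le_mul_iff_right (by simp; positivity) ENNReal.ofReal_ne_top] at h2
    exact (ENNReal.rpow_le_rpow_iff hp).1 h2
  refine ofReal_half_le_of_le_add hdc.le ?_ h3
  rw [← Real.volume_Icc]
  refine (measure_mono fun x hx => ?_).trans (measure_union_le _ _)
  rcases le_or_gt (U x) (κ * t) with h | h
  · exact Or.inl ⟨hx, h⟩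
  · exact Or.inr ⟨hx, h⟩

/-- A doubling property on subintervals gives the level set inequality of Gehring's argument. -/
theorem lintegral_level_set_le {U : ℝ → ℝ} (hU : Measurable U) (hpos : ∀ x, 0 < U x)
    {a b p K t : ℝ} (hab : a < b) (hfin : ∫⁻ x in Icc a b, ENNReal.ofReal (U x) ≠ ∞)
    (hp : 0 < p) (hK : 1 ≤ K) (ht0 : 0 < t)
    (hD : ∀ c d, a ≤ c → c < d → d ≤ b → ∀ E ⊆ Icc c d, MeasurableSet E →
      (∫⁻ x in Icc c d, ENNReal.ofReal (U x)) * volume E ^ p ≤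
        ENNReal.ofReal K * (∫⁻ x in E, ENNReal.ofReal (U x)) * ENNReal.ofReal (d - c) ^ p)
    (ht : ∫⁻ x in Icc a b, ENNReal.ofReal (U x) < ENNReal.ofReal (t * (b - a))) :
    ∫⁻ x in Icc a b ∩ {x | t < U x}, ENNReal.ofReal (U x) ≤
      ENNReal.ofReal (2 * K * 5 ^ p * t) * volume (Icc a b ∩ {x | (2 ^ p * K)⁻¹ * t < U x}) := by
  have hint : IntegrableOn U (Icc a b) := by
    refine ⟨hU.aestronglyMeasurable, ?_⟩
    rw [hasFiniteIntegral_iff_ofReal (.of_forall fun x => (hpos x).le)]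
    exact hfin.lt_top
  have hconv : ∀ c d, a ≤ c → c < d → d ≤ b →
      ∫⁻ x in Icc c d, ENNReal.ofReal (U x) = ENNReal.ofReal (∫ x in c..d, U x) := by
    intro c d hac hcd hdb
    rw [intervalIntegral.integral_of_le hcd.le, ← integral_Icc_eq_integral_Ioc,
      ofReal_integral_eq_lintegral_ofReal (hint.mono_set (Icc_subset_Icc hac hdb))
        (.of_forall fun x => (hpos x).le)]
  rw [hconv a b le_rfl hab le_rfl] at ht
  have ht' : ∫ x in a..b, U x < t * (b - a) := (ENNReal.ofReal_lt_ofReal_iff_of_nonneg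
    (intervalIntegral.integral_nonneg hab.le fun x _ => (hpos x).le)).1 ht
  have hae := ae_exists_interval_integral_eq hab hint ht'
  set G : Set ℝ := {x | x ∈ Icc a b ∧ t < U x ∧ ∃ c d, a ≤ c ∧ c < d ∧ d ≤ b ∧ x ∈ Icc c d ∧
      ∫ y in c..d, U y = t * (d - c)} with hG
  have hGx : ∀ x : ℝ, ∃ c d, x ∈ G → a ≤ c ∧ c < d ∧ d ≤ b ∧ x ∈ Icc c d ∧
      ∫ y in c..d, U y = t * (d - c) := by
    intro x
    by_cases hx : x ∈ G
    · obtain ⟨-, -, c, d, h⟩ := hx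
      exact ⟨c, d, fun _ => h⟩
    · exact ⟨0, 0, fun h => absurd h hx⟩
  choose c d hcd using hGx
  -- The stopping intervals are treated as closed balls: disjoint ones are selected whose fivefold
  -- enlargements cover all of them.
  obtain ⟨u, huG, hdisj, hcov⟩ := Vitali.exists_disjoint_subfamily_covering_enlargement_closedBall
    G (fun x => (c x + d x) / 2) (fun x => (d x - c x) / 2) ((b - a) / 2)
    (fun x hx => by obtain ⟨h1, h2, h3, -⟩ := hcd x hx; linarith) 5 (by norm_num)
  have hball : ∀ x, Metric.closedBall ((c x + d x) / 2) ((d x - c x) / 2) = Icc (c x) (d x) := by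
    intro x; rw [Real.closedBall_eq_Icc]; congr 1 <;> ring
  simp_rw [hball] at hdisj hcov
  have hcount : u.Countable := by
    refine hdisj.countable_of_nonempty_interior fun x hx => ?_
    rw [interior_Icc]
    exact nonempty_Ioo.2 (hcd x (huG hx)).2.1
  -- Enlargements are clipped to `[a, b]`, where doubling is available.
  set J' : ℝ → Set ℝ := fun x => Icc (max a ((c x + d x) / 2 - 5 * ((d x - c x) / 2)))
    (min b ((c x + d x) / 2 + 5 * ((d x - c x) / 2))) with hJ'
  set u' := volume.withDensity (fun x => ENNReal.ofReal (U x)) with hu'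
  have hu'a : ∀ s, MeasurableSet s → u' s = ∫⁻ x in s, ENNReal.ofReal (U x) := fun s hs =>
    withDensity_apply _ hs
  have hκm : MeasurableSet {x | (2 ^ p * K)⁻¹ * t < U x} := measurableSet_lt measurable_const hU
  have hlevel : MeasurableSet (Icc a b ∩ {x | t < U x}) :=
    measurableSet_Icc.inter (measurableSet_lt measurable_const hU)
  -- Doubling from the stopping interval to its enlargement costs `K * 5 ^ p`; replacing the
  -- interval by its part in the lower level set costs 2.
  have hone : ∀ x ∈ u, u' (J' x) ≤ ENNReal.ofReal (2 * K * 5 ^ p * t) *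
      volume (Icc (c x) (d x) ∩ {x | (2 ^ p * K)⁻¹ * t < U x}) := by
    intro x hx
    obtain ⟨hac, hlt, hdb, hxI, hint'⟩ := hcd x (huG hx)
    have hdc : 0 < d x - c x := sub_pos.2 hlt
    have hJ : ∫⁻ y in Icc (c x) (d x), ENNReal.ofReal (U y) =
        ENNReal.ofReal (t * (d x - c x)) := by rw [hconv _ _ hac hlt hdb, hint']
    have hhalf := half_length_le_volume_level_set hU hlt hp hK ht0 (hD _ _ hac hlt hdb) hJ
    set c' := max a ((c x + d x) / 2 - 5 * ((d x - c x) / 2)) with hc'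
    set d' := min b ((c x + d x) / 2 + 5 * ((d x - c x) / 2)) with hd'
    have hc'c : c' ≤ c x := max_le hac (by linarith)
    have hd'd : d x ≤ d' := le_min hdb (by linarith)
    have hlen : d' - c' ≤ 5 * (d x - c x) := by
      have := le_max_right a ((c x + d x) / 2 - 5 * ((d x - c x) / 2))
      have := min_le_right b ((c x + d x) / 2 + 5 * ((d x - c x) / 2))
      linarith
    have h1 := hD c' d' (le_max_left _ _) (by linarith) (min_le_left _ _) (Icc (c x) (d x))
      (Icc_subset_Icc hc'c hd'd) measurableSet_Icc
    rw [hJ, Real.volume_Icc] at h1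
    have h2 : u' (J' x) * ENNReal.ofReal (d x - c x) ^ p ≤
        ENNReal.ofReal (2 * K * 5 ^ p * t) * ENNReal.ofReal ((d x - c x) / 2) *
          ENNReal.ofReal (d x - c x) ^ p := by
      rw [hu'a _ measurableSet_Icc]
      refine h1.trans ((by gcongr : _ ≤ ENNReal.ofReal K * ENNReal.ofReal (t * (d x - c x)) *
        ENNReal.ofReal (5 * (d x - c x)) ^ p).trans (le_of_eq ?_))
      rw [ENNReal.ofReal_rpow_of_pos hdc, ENNReal.ofReal_rpow_of_pos (by positivity),
        ← ENNReal.ofReal_mul (by positivity), ← ENNReal.ofReal_mul (by positivity),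
        ← ENNReal.ofReal_mul (by positivity), ← ENNReal.ofReal_mul (by positivity),
        Real.mul_rpow (by norm_num) hdc.le]
      congr 1
      ring
    rw [ENNReal.mul_le_mul_iff_left] at h2
    · exact h2.trans (by gcongr)
    · rw [ENNReal.ofReal_rpow_of_pos hdc]; simp; positivity
    · rw [ENNReal.ofReal_rpow_of_pos hdc]; exact ENNReal.ofReal_ne_top
  have hcover : u' (Icc a b ∩ {x | t < U x}) ≤ u' (⋃ x ∈ u, J' x) := by
    refine measure_mono_ae ?_
    filter_upwards [(withDensity_absolutelyContinuous volume _).ae_le hae] with x hx hxm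
    have hxG : x ∈ G := ⟨hxm.1, hxm.2, hx hxm.1 hxm.2⟩
    obtain ⟨y, hyu, hy⟩ := hcov x hxG
    have := hy (hcd x hxG).2.2.2.1
    rw [Real.closedBall_eq_Icc] at this
    exact mem_iUnion₂.2 ⟨y, hyu, max_le hxm.1.1 this.1, le_min hxm.1.2 this.2⟩
  rw [← hu'a _ hlevel]
  have := hcount.to_subtype
  calc u' (Icc a b ∩ {x | t < U x}) ≤ u' (⋃ x ∈ u, J' x) := hcover
    _ ≤ ∑' x : u, u' (J' x) := measure_biUnion_le _ hcount _
    _ ≤ ∑' x : u, ENNReal.ofReal (2 * K * 5 ^ p * t) *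
        volume (Icc (c x) (d x) ∩ {x | (2 ^ p * K)⁻¹ * t < U x}) :=
      ENNReal.tsum_le_tsum fun x => hone x x.2
    _ = ENNReal.ofReal (2 * K * 5 ^ p * t) *
        volume (⋃ x ∈ u, Icc (c x) (d x) ∩ {x | (2 ^ p * K)⁻¹ * t < U x}) := by
      rw [ENNReal.tsum_mul_left, measure_biUnion hcount]
      · exact fun x hx y hy hxy => (hdisj hx hy hxy).mono inter_subset_left inter_subset_left
      · exact fun x _ => measurableSet_Icc.inter hκm
    _ ≤ _ := by
      gcongr
      refine iUnion₂_subset fun x hx => inter_subset_inter_left _ ?_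
      obtain ⟨hac, hlt, hdb, -⟩ := hcd x (huG hx)
      exact Icc_subset_Icc hac hdb

/-! ### Reverse Hölder inequality on an interval -/

/-- Hölder's inequality: the Muckenhoupt condition on `J` controls the weighted measure of subsets. -/
theorem lintegral_mul_volume_rpow_le {α : Type*} [MeasurableSpace α] {μ : Measure α} {U : α → ℝ}
    (hU : Measurable U) (hpos : ∀ x, 0 < U x) {s : ℝ} (hs : 0 < s) {E J : Set α} (hEJ : E ⊆ J) :
    μ E ^ (1 + 1 / s) ≤ (∫⁻ x in E, ENNReal.ofReal (U x) ∂μ) *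
      (∫⁻ x in J, ENNReal.ofReal (U x ^ (-s)) ∂μ) ^ (1 / s) := by
  have h := ENNReal.lintegral_mul_norm_pow_le (μ := μ.restrict E)
    (f := fun x => ENNReal.ofReal (U x)) (g := fun x => ENNReal.ofReal (U x ^ (-s)))
    (by fun_prop) (by fun_prop) (p := s / (1 + s)) (q := 1 / (1 + s)) (by positivity)
    (by positivity) (by field_simp; ring)
  -- Hölder is applied to the factorization of 1 into powers of `U` and `U ^ (-s)`.
  have e : ∀ x, ENNReal.ofReal (U x) ^ (s / (1 + s)) *
      ENNReal.ofReal (U x ^ (-s)) ^ (1 / (1 + s)) = 1 := by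
    intro x
    have hx := hpos x
    rw [ENNReal.ofReal_rpow_of_pos hx, ENNReal.ofReal_rpow_of_pos (Real.rpow_pos_of_pos hx _),
      ← ENNReal.ofReal_mul (by positivity), ← Real.rpow_mul hx.le, ← Real.rpow_add hx]
    rw [show s / (1 + s) + -s * (1 / (1 + s)) = 0 by ring]
    simp
  simp_rw [e] at h
  rw [setLIntegral_const, one_mul] at h
  calc μ E ^ (1 + 1 / s) ≤ ((∫⁻ x in E, ENNReal.ofReal (U x) ∂μ) ^ (s / (1 + s)) *
      (∫⁻ x in J, ENNReal.ofReal (U x ^ (-s)) ∂μ) ^ (1 / (1 + s))) ^ (1 + 1 / s) := by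
        gcongr
        exact h.trans (by gcongr)
    _ = _ := by
      rw [ENNReal.mul_rpow_of_nonneg _ _ (by positivity), ← ENNReal.rpow_mul, ← ENNReal.rpow_mul]
      rw [show s / (1 + s) * (1 + 1 / s) = 1 by field_simp; ring,
        show 1 / (1 + s) * (1 + 1 / s) = 1 / s by field_simp; ring, ENNReal.rpow_one]

/-- The reverse Hölder inequality on an interval of the line, with constants depending only on
the exponent and the Muckenhoupt constant. -/
theorem exists_reverse_holder_interval {s K : ℝ} (hs : 0 < s) (hK : 1 ≤ K) :
    ∃ ε > (0 : ℝ), ∃ C : ℝ≥0∞, C ≠ ∞ ∧ ∀ (U : ℝ → ℝ) (a b : ℝ), Measurable U → (∀ x, 0 < U x) → a < b →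
      ∫⁻ x in Icc a b, ENNReal.ofReal (U x) ≠ ∞ →
      (∀ c d, a ≤ c → c < d → d ≤ b →
        ((ENNReal.ofReal (d - c))⁻¹ * ∫⁻ x in Icc c d, ENNReal.ofReal (U x)) *
          ((ENNReal.ofReal (d - c))⁻¹ * ∫⁻ x in Icc c d, ENNReal.ofReal (U x ^ (-s))) ^ (1 / s)
            ≤ ENNReal.ofReal K) →
      (ENNReal.ofReal (b - a))⁻¹ * ∫⁻ x in Icc a b, ENNReal.ofReal (U x ^ (1 + ε)) ≤
        C * ((ENNReal.ofReal (b - a))⁻¹ * ∫⁻ x in Icc a b, ENNReal.ofReal (U x)) ^ (1 + ε) := by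
  set p := 1 + 1 / s with hp
  have hp0 : 0 < p := by positivity
  set A := 2 * K * 5 ^ p with hA
  set c := (2 ^ p * K)⁻¹ with hc
  have hA0 : 0 < A := by positivity
  have hc0 : 0 < c := by positivity
  have hc1 : c ≤ 1 := by
    have := Real.one_le_rpow (show (1 : ℝ) ≤ 2 by norm_num) hp0.le
    exact inv_le_one_of_one_le₀ (by nlinarith)
  have hA1 : 1 ≤ A := by
    have := Real.one_le_rpow (show (1 : ℝ) ≤ 5 by norm_num) hp0.le
    nlinarith
  have hε0 : 0 < c ^ 2 / (2 * A) := by positivity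
  have hε1 : c ^ 2 / (2 * A) ≤ 1 := by
    rw [div_le_one (by positivity)]; nlinarith
  -- Since `c ≤ 1` and `ε ≤ 1`, `c ^ (1 + ε) ≥ c ^ 2`; this `ε` then meets the absorption condition.
  set ε := c ^ 2 / (2 * A) with hε
  have hεA : ε * A * (c ^ (1 + ε))⁻¹ ≤ 1 / 2 := by
    have h1 : c ^ (2 : ℝ) ≤ c ^ (1 + ε) :=
      Real.rpow_le_rpow_of_exponent_ge hc0 hc1 (by linarith)
    rw [Real.rpow_two] at h1
    have h2 : ε * A = c ^ 2 / 2 := by rw [hε]; field_simp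
    rw [h2, ← div_eq_mul_inv, div_le_iff₀ (by positivity)]
    linarith
  refine ⟨ε, hε0, ENNReal.ofReal (2 * 2 ^ ε), ENNReal.ofReal_ne_top, ?_⟩
  intro U a b hU hpos hab hfin hM
  have hba : 0 < b - a := sub_pos.2 hab
  have hne : ∫⁻ x in Icc a b, ENNReal.ofReal (U x) ≠ 0 := by
    rw [← pos_iff_ne_zero, setLIntegral_pos_iff (by fun_prop)]
    have : Function.support (fun x => ENNReal.ofReal (U x)) = univ := by
      ext x; simp [hpos x]
    rw [this, univ_inter, Real.volume_Icc]
    simpa using hab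
  obtain ⟨m, hm0, hm⟩ : ∃ m : ℝ, 0 < m ∧
      ∫⁻ x in Icc a b, ENNReal.ofReal (U x) = ENNReal.ofReal (m * (b - a)) := by
    refine ⟨(∫⁻ x in Icc a b, ENNReal.ofReal (U x)).toReal / (b - a),
      div_pos (ENNReal.toReal_pos hne hfin) hba, ?_⟩
    rw [div_mul_cancel₀ _ hba.ne', ENNReal.ofReal_toReal hfin]
  have hD : ∀ c d, a ≤ c → c < d → d ≤ b → ∀ E ⊆ Icc c d, MeasurableSet E →
      (∫⁻ x in Icc c d, ENNReal.ofReal (U x)) * volume E ^ p ≤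
        ENNReal.ofReal K * (∫⁻ x in E, ENNReal.ofReal (U x)) * ENNReal.ofReal (d - c) ^ p := by
    intro c d hac hcd hdb E hE _
    have h1 := hM c d hac hcd hdb
    have h2 := lintegral_mul_volume_rpow_le (μ := volume) hU hpos hs hE
    have hl0 : ENNReal.ofReal (d - c) ≠ 0 := by simpa using hcd
    have hlt : ENNReal.ofReal (d - c) ≠ ∞ := ENNReal.ofReal_ne_top
    set l := ENNReal.ofReal (d - c)
    set S := ∫⁻ x in Icc c d, ENNReal.ofReal (U x ^ (-s))
    set u := ∫⁻ x in Icc c d, ENNReal.ofReal (U x)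
    have h3 : u * S ^ (1 / s) ≤ ENNReal.ofReal K * l ^ p := by
      calc u * S ^ (1 / s) = (l⁻¹ * u) * (l⁻¹ * S) ^ (1 / s) * l ^ p := by
            rw [ENNReal.mul_rpow_of_nonneg _ _ (by positivity), hp,
              ENNReal.rpow_add _ _ hl0 hlt, ENNReal.rpow_one, ENNReal.inv_rpow]
            have i1 : l⁻¹ * l = 1 := ENNReal.inv_mul_cancel hl0 hlt
            have i2 : (l ^ (1 / s))⁻¹ * l ^ (1 / s) = 1 := by
              refine ENNReal.inv_mul_cancel ?_ ?_
              · simp [ENNReal.rpow_eq_zero_iff, hl0, hlt]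
              · simp [ENNReal.rpow_eq_top_iff, hl0, hlt]
            calc u * S ^ (1 / s) = (l⁻¹ * l) * ((l ^ (1 / s))⁻¹ * l ^ (1 / s)) *
                  (u * S ^ (1 / s)) := by rw [i1, i2]; simp
              _ = _ := by ring
        _ ≤ _ := by gcongr
    calc u * volume E ^ p ≤ u * ((∫⁻ x in E, ENNReal.ofReal (U x)) * S ^ (1 / s)) := by gcongr
      _ = (u * S ^ (1 / s)) * ∫⁻ x in E, ENNReal.ofReal (U x) := by ring
      _ ≤ ENNReal.ofReal K * l ^ p * ∫⁻ x in E, ENNReal.ofReal (U x) := by gcongr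
      _ = _ := by ring
  -- Levels start at twice the mean `m`, so each exceeds the mean over `[a, b]` strictly, as the
  -- stopping argument requires.
  have hG := lintegral_rpow_le_of_level_set_le (μ := volume.restrict (Icc a b)) hU hpos hfin
    hA0.le hc0 hc1 (L := 2 * m) (by positivity) hε0 hεA (fun t ht => by
      have ht0 : 0 < t := by linarith
      have := lintegral_level_set_le hU hpos hab hfin hp0 hK ht0 hD (by
        rw [hm]
        refine (ENNReal.ofReal_lt_ofReal_iff (by positivity)).2 ?_
        have : m < t := by linarith
        gcongr)
      rw [Measure.restrict_restrict (measurableSet_lt measurable_const hU),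
        Measure.restrict_apply (measurableSet_lt measurable_const hU), inter_comm,
        inter_comm {x | c * t < U x}]
      exact this)
  rw [hm] at hG ⊢
  rw [← ENNReal.ofReal_inv_of_pos hba, ← ENNReal.ofReal_mul (by positivity)]
  refine (mul_le_mul_right hG _).trans (le_of_eq ?_)
  rw [show (2 : ℝ≥0∞) = ENNReal.ofReal 2 by simp, ENNReal.ofReal_rpow_of_pos (by positivity),
    ← ENNReal.ofReal_mul (by positivity), ← ENNReal.ofReal_mul (by positivity),
    ← ENNReal.ofReal_mul (by positivity), ← ENNReal.ofReal_mul (by positivity)]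
  congr 1
  rw [show (b - a)⁻¹ * (m * (b - a)) = m by field_simp, Real.rpow_add hm0, Real.rpow_one,
    Real.mul_rpow (by norm_num) hm0.le]
  field_simp

/-! ### Arcs of the circle and averages over them -/

theorem measurableSet_of_mem_circleArcs {I : Set UnitAddCircle} (hI : I ∈ circleArcs) :
    MeasurableSet I := by
  obtain ⟨x, ℓ, -, -, rfl⟩ := hI
  exact (isCompact_Icc.image (AddCircle.continuous_mk' 1)).isClosed.measurableSet

/-- The fundamental domain `(x, x + 1]` is used. Off its endpoints, a point `y` of it and a point of
`[x, x + ℓ]` over the same circle point differ by an integer in `(-1, 1)`, hence coincide; this is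
where `ℓ ≤ 1` enters. -/
theorem setLIntegral_arc {x ℓ : ℝ} (h0 : 0 < ℓ) (h1 : ℓ ≤ 1) (F : UnitAddCircle → ℝ≥0∞) :
    ∫⁻ y in (fun s : ℝ => (s : UnitAddCircle)) '' Icc x (x + ℓ), F y =
      ∫⁻ y in Icc x (x + ℓ), F (y : UnitAddCircle) := by
  set I := (fun s : ℝ => (s : UnitAddCircle)) '' Icc x (x + ℓ) with hI
  have hIm : MeasurableSet I := measurableSet_of_mem_circleArcs ⟨x, ℓ, h0, h1, rfl⟩
  have hpm : MeasurableSet ((fun s : ℝ => (s : UnitAddCircle)) ⁻¹' I) :=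
    (AddCircle.continuous_mk' 1).measurable hIm
  rw [← lintegral_indicator hIm, ← UnitAddCircle.lintegral_preimage x]
  have e : ∀ y : ℝ, I.indicator F (y : UnitAddCircle) =
      ((fun s : ℝ => (s : UnitAddCircle)) ⁻¹' I).indicator (fun y : ℝ => F y) y := fun y => rfl
  simp_rw [e]
  rw [lintegral_indicator hpm, Measure.restrict_restrict hpm]
  refine setLIntegral_congr ?_
  filter_upwards [Measure.ae_ne volume x, Measure.ae_ne volume (x + 1)] with y hyx hyx1
  refine propext ⟨?_, ?_⟩
  · rintro ⟨⟨z, hz, hzy⟩, hy⟩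
    have hzy : (z : UnitAddCircle) = (y : UnitAddCircle) := hzy
    rw [← sub_eq_zero, ← AddCircle.coe_sub, AddCircle.coe_eq_zero_iff] at hzy
    obtain ⟨n, hn⟩ := hzy
    have hy1 : y < x + 1 := lt_of_le_of_ne hy.2 hyx1
    have hy0 : x < y := hy.1
    have hn : (n : ℝ) = z - y := by simpa using hn
    have l1 : (-1 : ℝ) < n := by rw [hn]; linarith [hz.1]
    have l2 : (n : ℝ) < 1 := by rw [hn]; linarith [hz.2]
    have l1' : -1 < n := by exact_mod_cast l1
    have l2' : n < 1 := by exact_mod_cast l2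
    obtain rfl : n = 0 := by omega
    have : z = y := by simpa [sub_eq_zero, eq_comm] using hn
    exact this ▸ hz
  · intro hy
    exact ⟨⟨y, hy, rfl⟩, lt_of_le_of_ne hy.1 (Ne.symm hyx), hy.2.trans (by linarith)⟩

theorem volume_arc {x ℓ : ℝ} (h0 : 0 < ℓ) (h1 : ℓ ≤ 1) :
    volume ((fun s : ℝ => (s : UnitAddCircle)) '' Icc x (x + ℓ)) = ENNReal.ofReal ℓ := by
  have := setLIntegral_arc (x := x) h0 h1 (fun _ => 1)
  simpa using this

theorem powAvg_arc {x ℓ : ℝ} (h0 : 0 < ℓ) (h1 : ℓ ≤ 1) (f : UnitAddCircle → ℝ) (s : ℝ) :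
    powAvg ((fun s : ℝ => (s : UnitAddCircle)) '' Icc x (x + ℓ)) f s =
      (ENNReal.ofReal ℓ)⁻¹ * ∫⁻ y in Icc x (x + ℓ), ENNReal.ofReal (f (y : UnitAddCircle) ^ s) := by
  rw [powAvg, setLAverage_eq, volume_arc h0 h1, setLIntegral_arc h0 h1, ENNReal.div_eq_inv_mul]

theorem volume_ne_zero_of_mem_circleArcs {I : Set UnitAddCircle} (hI : I ∈ circleArcs) :
    volume I ≠ 0 := by
  obtain ⟨x, ℓ, h0, h1, rfl⟩ := hI
  rw [volume_arc h0 h1]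
  simpa using h0

/-- The normalized measure of an arc, with respect to which `powAvg` is an integral. -/
noncomputable def arcMeasure (I : Set UnitAddCircle) : Measure UnitAddCircle :=
  (volume.restrict I univ)⁻¹ • volume.restrict I

theorem powAvg_eq_lintegral (I : Set UnitAddCircle) (f : UnitAddCircle → ℝ) (s : ℝ) :
    powAvg I f s = ∫⁻ x, ENNReal.ofReal (f x ^ s) ∂arcMeasure I := rfl

theorem isProbabilityMeasure_arcMeasure {I : Set UnitAddCircle} (hI : I ∈ circleArcs) :
    IsProbabilityMeasure (arcMeasure I) := by
  constructor
  rw [arcMeasure, Measure.smul_apply, smul_eq_mul, Measure.restrict_apply_univ]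
  exact ENNReal.inv_mul_cancel (volume_ne_zero_of_mem_circleArcs hI) (measure_ne_top _ _)

theorem arcMeasure_absolutelyContinuous (I : Set UnitAddCircle) : arcMeasure I ≪ volume :=
  (Measure.smul_absolutelyContinuous).trans Measure.absolutelyContinuous_restrict

theorem powAvg_congr {I : Set UnitAddCircle} {f g : UnitAddCircle → ℝ} {s r : ℝ}
    (h : ∀ᵐ x, f x ^ s = g x ^ r) : powAvg I f s = powAvg I g r := by
  rw [powAvg_eq_lintegral, powAvg_eq_lintegral]
  refine lintegral_congr_ae ?_
  filter_upwards [(arcMeasure_absolutelyContinuous I).ae_le h] with x hx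
  rw [hx]

theorem powAvg_ne_zero {I : Set UnitAddCircle} (hI : I ∈ circleArcs) {f : UnitAddCircle → ℝ}
    (hf : IsWeight f) (s : ℝ) : powAvg I f s ≠ 0 := by
  have := isProbabilityMeasure_arcMeasure hI
  rw [powAvg_eq_lintegral]
  have hac := arcMeasure_absolutelyContinuous I
  have hm : AEMeasurable f (arcMeasure I) := hf.1.mono_ac hac
  rw [Ne, lintegral_eq_zero_iff' (by fun_prop)]
  intro h
  have : ∀ᵐ x ∂arcMeasure I, False := by
    filter_upwards [h, hac.ae_le hf.2] with x hx hpos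
    have := Real.rpow_pos_of_pos hpos s
    simp at hx
    linarith
  have : arcMeasure I = 0 := by simpa using this
  exact IsProbabilityMeasure.ne_zero (arcMeasure I) this

/-- Hölder's inequality on an arc for a geometric mean of two weights. -/
theorem powAvg_rpow_mul_rpow_le {I : Set UnitAddCircle} (hI : I ∈ circleArcs)
    {w a : UnitAddCircle → ℝ} (hw : IsWeight w) (ha : IsWeight a) {t e m n α β : ℝ}
    (hα : 0 ≤ α) (hβ : 0 ≤ β) (hαβ : α + β ≤ 1) (hm : m * α = t * e) (hn : n * β = (1 - t) * e) :
    powAvg I (fun x => w x ^ t * a x ^ (1 - t)) e ≤ powAvg I w m ^ α * powAvg I a n ^ β := by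
  have := isProbabilityMeasure_arcMeasure hI
  have hac := arcMeasure_absolutelyContinuous I
  have hwm : AEMeasurable w (arcMeasure I) := hw.1.mono_ac hac
  have ham : AEMeasurable a (arcMeasure I) := ha.1.mono_ac hac
  -- The third function, the constant 1 on a probability space, takes up the slack `1 - α - β`.
  have h := ENNReal.lintegral_prod_norm_pow_le (μ := arcMeasure I) (Finset.univ : Finset (Fin 3))
    (f := ![fun x => ENNReal.ofReal (w x ^ m), fun x => ENNReal.ofReal (a x ^ n), fun _ => 1])
    (by
      intro i _
      fin_cases i
      · exact (hwm.pow_const m).ennreal_ofReal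
      · exact (ham.pow_const n).ennreal_ofReal
      · exact aemeasurable_const)
    (p := ![α, β, 1 - α - β]) (by simp [Fin.sum_univ_three])
    (by
      intro i _
      fin_cases i
      · exact hα
      · exact hβ
      · simp; linarith)
  simp only [Fin.prod_univ_three, Matrix.cons_val_zero, Matrix.cons_val_one, Matrix.cons_val,
    ENNReal.one_rpow, mul_one, lintegral_one, measure_univ] at h
  rw [powAvg_eq_lintegral, powAvg_eq_lintegral, powAvg_eq_lintegral]
  refine le_trans (le_of_eq (lintegral_congr_ae ?_)) h
  filter_upwards [hac.ae_le hw.2, hac.ae_le ha.2] with x hwx hax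
  rw [ENNReal.ofReal_rpow_of_pos (by positivity), ENNReal.ofReal_rpow_of_pos (by positivity),
    ← ENNReal.ofReal_mul (by positivity), ← Real.rpow_mul hwx.le, ← Real.rpow_mul hax.le,
    Real.mul_rpow (by positivity) (by positivity), ← Real.rpow_mul hwx.le, ← Real.rpow_mul hax.le,
    hm, hn]

/-! ### Reverse Hölder and Muckenhoupt conditions on the circle -/

/-- The reverse Hölder inequality for Muckenhoupt weights on the circle. -/
theorem exists_reverse_holder {u : UnitAddCircle → ℝ} (hu : IsWeight u) {s : ℝ} (hs : 0 < s)
    {K : ℝ≥0∞} (hK : K ≠ ∞)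
    (h : ∀ I ∈ circleArcs, powAvg I u 1 * powAvg I u (-s) ^ (1 / s) ≤ K) :
    ∃ ε > (0 : ℝ), ∃ C : ℝ≥0∞, C ≠ ∞ ∧
      ∀ I ∈ circleArcs, powAvg I u (1 + ε) ≤ C * powAvg I u 1 ^ (1 + ε) := by
  -- The interval version needs a measurable, everywhere positive function, so `u` is changed on a
  -- null set.
  obtain ⟨v, hvm, hvpos, hv⟩ : ∃ v : UnitAddCircle → ℝ, Measurable v ∧ (∀ x, 0 < v x) ∧
      ∀ᵐ x, u x = v x := by
    refine ⟨fun x => if 0 < hu.1.mk u x then hu.1.mk u x else 1,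
      Measurable.ite (measurableSet_lt measurable_const hu.1.measurable_mk)
        hu.1.measurable_mk measurable_const, fun x => ?_, ?_⟩
    · dsimp only
      split_ifs with hx
      · exact hx
      · norm_num
    · filter_upwards [hu.1.ae_eq_mk, hu.2] with x hx hpos
      rw [← hx, if_pos hpos]
  have hcongr : ∀ I s, powAvg I u s = powAvg I v s := fun I s =>
    powAvg_congr (by filter_upwards [hv] with x hx; rw [hx])
  have hvw : IsWeight v := ⟨hvm.aemeasurable, .of_forall hvpos⟩
  simp_rw [hcongr] at h ⊢
  obtain ⟨ε, hε, C, hC, hRH⟩ := exists_reverse_holder_interval hs (le_max_right K.toReal 1)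
  refine ⟨ε, hε, C, hC, ?_⟩
  rintro _ ⟨x, ℓ, h0, h1, rfl⟩
  have hmeas : Measurable (fun y : ℝ => v (y : UnitAddCircle)) :=
    hvm.comp (AddCircle.continuous_mk' 1).measurable
  -- An infinite average would make the bounded product infinite, because the other factor is
  -- nonzero.
  have hfin : powAvg ((fun s : ℝ => (s : UnitAddCircle)) '' Icc x (x + ℓ)) v 1 ≠ ∞ := by
    intro htop
    have hI : (fun s : ℝ => (s : UnitAddCircle)) '' Icc x (x + ℓ) ∈ circleArcs :=
      ⟨x, ℓ, h0, h1, rfl⟩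
    have := h _ hI
    rw [htop, ENNReal.top_mul] at this
    · exact hK (top_le_iff.1 this)
    · simp [ENNReal.rpow_eq_zero_iff, powAvg_ne_zero hI hvw, hs, hs.le]
  rw [powAvg_arc h0 h1] at hfin
  have := hRH (fun y : ℝ => v (y : UnitAddCircle)) x (x + ℓ) hmeas (fun y => hvpos _)
    (by linarith) (by
      intro htop
      refine hfin ?_
      simp_rw [Real.rpow_one]
      rw [htop, ENNReal.mul_top]
      simp) (by
      intro c d hc hcd hd
      have := h _ ⟨c, d - c, by linarith, by linarith, rfl⟩
      rw [powAvg_arc (by linarith) (by linarith), powAvg_arc (by linarith) (by linarith)] at this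
      simp_rw [Real.rpow_one, add_sub_cancel] at this
      refine this.trans ?_
      rw [← ENNReal.ofReal_toReal hK]
      exact ENNReal.ofReal_le_ofReal (by simp [ENNReal.toReal_ofReal]))
  rw [powAvg_arc h0 h1, powAvg_arc h0 h1]
  simp_rw [add_sub_cancel_left] at this
  simpa only [Real.rpow_one] using this

/-- An `A₁` weight dominates its averages on arcs. -/
theorem MuckenhouptA.powAvg_mul_le {u : UnitAddCircle → ℝ} (hu : MuckenhouptA 1 u) :
    ∃ C : ℝ≥0, ∀ γ > (0 : ℝ), ∀ I ∈ circleArcs,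
      powAvg I u 1 * powAvg I u (-γ) ^ (1 / γ) ≤ C := by
  obtain ⟨hw, hA⟩ := hu
  rw [if_pos rfl] at hA
  obtain ⟨C, hC⟩ := hA
  refine ⟨C, fun γ hγ I hI => ?_⟩
  have := isProbabilityMeasure_arcMeasure hI
  have hac := arcMeasure_absolutelyContinuous I
  set M := powAvg I u 1 with hMdef
  have hmem : ∀ᵐ x ∂arcMeasure I, x ∈ I :=
    (Measure.smul_absolutelyContinuous : arcMeasure I ≪ volume.restrict I).ae_le
      (ae_restrict_mem (measurableSet_of_mem_circleArcs hI))
  have hM : M = ⨍⁻ y in I, ENNReal.ofReal |u y| ∂volume := by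
    refine lintegral_congr_ae ?_
    filter_upwards [hac.ae_le hw.2] with x hx
    rw [Real.rpow_one, abs_of_pos hx]
  have hle : ∀ᵐ x ∂arcMeasure I, 0 < u x ∧ M ≤ C * ENNReal.ofReal (u x) := by
    filter_upwards [hmem, hac.ae_le hC, hac.ae_le hw.2] with x hxI hx hpos
    refine ⟨hpos, le_trans ?_ hx⟩
    rw [hM]
    exact le_iSup₂_of_le (f := fun I (_ : I ∈ {I | I ∈ circleArcs ∧ x ∈ I}) =>
      ⨍⁻ y in I, ENNReal.ofReal |u y| ∂volume) I ⟨hI, hxI⟩ le_rfl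
  have hM0 : M ≠ 0 := powAvg_ne_zero hI hw 1
  have hMtop : M ≠ ∞ := by
    obtain ⟨x, -, hx⟩ := hle.exists
    exact ne_top_of_le_ne_top (ENNReal.mul_ne_top ENNReal.coe_ne_top ENNReal.ofReal_ne_top) hx
  -- Almost everywhere on the arc `u ≥ M / C`, so `u ^ (-γ) ≤ (C / M) ^ γ`.
  have hneg : powAvg I u (-γ) ≤ (C * M⁻¹) ^ γ := by
    rw [powAvg_eq_lintegral, ← mul_one ((C * M⁻¹) ^ γ), ← measure_univ (μ := arcMeasure I),
      ← lintegral_const]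
    refine lintegral_mono_ae ?_
    filter_upwards [hle] with x hx
    obtain ⟨hpos, hx⟩ := hx
    rw [Real.rpow_neg hpos.le, ← Real.inv_rpow hpos.le,
      ← ENNReal.ofReal_rpow_of_pos (inv_pos.2 hpos), ENNReal.ofReal_inv_of_pos hpos]
    gcongr
    rw [← div_eq_mul_inv, ENNReal.le_div_iff_mul_le (.inl hM0) (.inl hMtop), mul_comm,
      ← div_eq_mul_inv]
    exact ENNReal.div_le_of_le_mul hx
  calc M * powAvg I u (-γ) ^ (1 / γ) ≤ M * ((C * M⁻¹) ^ γ) ^ (1 / γ) := by gcongr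
    _ = C * (M⁻¹ * M) := by
      rw [← ENNReal.rpow_mul, mul_one_div_cancel hγ.ne', ENNReal.rpow_one]; ring
    _ = C := by rw [ENNReal.inv_mul_cancel hM0 hMtop, mul_one]

/-- The case `p = 1` is absorbed into `A_2`, so only product conditions with exponent above 1
remain. -/
theorem MuckenhouptAInfty.exists_powAvg_mul_le {a : UnitAddCircle → ℝ} (ha : MuckenhouptAInfty a) :
    IsWeight a ∧ ∃ s > (1 : ℝ), ∃ K : ℝ≥0∞, K ≠ ∞ ∧ ∀ I ∈ circleArcs,
      powAvg I a 1 * powAvg I a (-(1 / (s - 1))) ^ (s - 1) ≤ K := by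
  obtain ⟨p, hp1, hp⟩ := ha
  refine ⟨hp.1, ?_⟩
  rcases hp1.eq_or_lt with rfl | hp1
  · obtain ⟨C, hC⟩ := hp.powAvg_mul_le
    refine ⟨2, by norm_num, C, ENNReal.coe_ne_top, fun I hI => ?_⟩
    have := hC 1 one_pos I hI
    norm_num at this ⊢
    exact this
  · have h := hp.2
    rw [if_neg hp1.ne'] at h
    exact ⟨p, hp1, _, h.ne, fun I hI => le_iSup₂_of_le
      (f := fun I (_ : I ∈ circleArcs) => powAvg I a 1 * powAvg I a (-(1 / (p - 1))) ^ (p - 1))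
      I hI le_rfl⟩

/-! ### The conditions `α_p` and geometric means of weights -/

theorem alphaCondition_iff {p : ℝ} (h1 : 1 < p) (h2 : p < 2) {w : UnitAddCircle → ℝ} :
    AlphaCondition p w ↔ IsWeight w ∧ ∃ K : ℝ≥0∞, K ≠ ∞ ∧ ∀ I ∈ circleArcs,
      powAvg I w (-(1 / (p - 1))) ^ (p - 1) * powAvg I w (2 / (2 - p)) ^ ((2 - p) / 2) ≤ K := by
  rw [AlphaCondition, if_neg h1.ne', if_neg h2.ne]
  refine and_congr_right fun _ => ⟨fun h => ⟨_, h.ne, fun I hI => ?_⟩, ?_⟩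
  · exact le_iSup₂_of_le (f := fun I (_ : I ∈ circleArcs) => powAvg I w (-(1 / (p - 1))) ^ (p - 1) *
      powAvg I w (2 / (2 - p)) ^ ((2 - p) / 2)) I hI le_rfl
  · rintro ⟨K, hK, h⟩
    exact (iSup₂_le h).trans_lt hK.lt_top

theorem IsWeight.rpow {w : UnitAddCircle → ℝ} (hw : IsWeight w) (s : ℝ) :
    IsWeight (fun x => w x ^ s) :=
  ⟨hw.1.pow_const s, by filter_upwards [hw.2] with x hx; exact Real.rpow_pos_of_pos hx s⟩

theorem IsWeight.mul {w a : UnitAddCircle → ℝ} (hw : IsWeight w) (ha : IsWeight a) :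
    IsWeight (fun x => w x * a x) :=
  ⟨hw.1.mul ha.1, by filter_upwards [hw.2, ha.2] with x hx hy; exact mul_pos hx hy⟩

/-- The condition `α₁` improves to `α_r` for some `r > 1`. -/
theorem AlphaCondition.exists_one_lt {w : UnitAddCircle → ℝ} (hw : AlphaCondition 1 w) :
    ∃ r ∈ Ioo (1 : ℝ) 2, AlphaCondition r w := by
  obtain ⟨hww, hA⟩ := hw
  rw [if_pos rfl] at hA
  obtain ⟨C, hC⟩ := hA.powAvg_mul_le
  obtain ⟨ε, hε, C', hC', hRH⟩ := exists_reverse_holder hA.1 one_pos ENNReal.coe_ne_top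
    (hC 1 one_pos)
  have hr : 1 / (1 + ε) < 1 := by rw [div_lt_one (by positivity)]; linarith
  have hr0 : 0 < 1 / (1 + ε) := by positivity
  -- This `r` makes `w ^ (2 / (2 - r))` equal to `(w ^ 2) ^ (1 + ε)`, the power that reverse Hölder
  -- controls.
  obtain ⟨r, hr1, hr2, hre⟩ : ∃ r : ℝ, 1 < r ∧ r < 2 ∧ 2 - r = 1 / (1 + ε) :=
    ⟨2 - 1 / (1 + ε), by linarith, by linarith, by ring⟩
  have hr1' : 0 < r - 1 := by linarith
  refine ⟨r, ⟨hr1, hr2⟩, (alphaCondition_iff hr1 hr2).2 ⟨hww,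
    (C' ^ (1 / (1 + ε)) * C) ^ (1 / 2 : ℝ), ?_, fun I hI => ?_⟩⟩
  · exact ENNReal.rpow_ne_top_of_nonneg (by norm_num) (ENNReal.mul_ne_top
      (ENNReal.rpow_ne_top_of_nonneg hr0.le hC') ENNReal.coe_ne_top)
  set γ := 1 / (2 * (r - 1)) with hγ
  have hγ0 : 0 < γ := by positivity
  have hsq : ∀ x : ℝ, 0 < x → ∀ s : ℝ, x ^ (2 * s) = (x ^ 2) ^ s := fun x hx s => by
    rw [Real.rpow_mul hx.le, Real.rpow_two]
  have e1 : powAvg I w (2 / (2 - r)) = powAvg I (fun x => w x ^ 2) (1 + ε) := powAvg_congr (by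
    filter_upwards [hww.2] with x hx
    rw [← hsq _ hx, hre]
    congr 1; field_simp)
  have e2 : powAvg I w (-(1 / (r - 1))) = powAvg I (fun x => w x ^ 2) (-γ) := powAvg_congr (by
    filter_upwards [hww.2] with x hx
    rw [← hsq _ hx, hγ]
    congr 1; field_simp)
  have h1 := hC γ hγ0 I hI
  have h2 := hRH I hI
  rw [e1, e2, hre, show r - 1 = (1 / γ) * (1 / 2) by rw [hγ]; field_simp,
    show 1 / (1 + ε) / 2 = 1 / (1 + ε) * (1 / 2) by ring, ENNReal.rpow_mul,
    ENNReal.rpow_mul _ (1 / (1 + ε)),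
    ← ENNReal.mul_rpow_of_nonneg _ _ (by norm_num)]
  set M := powAvg I (fun x => w x ^ 2) 1
  set N := powAvg I (fun x => w x ^ 2) (-γ)
  refine ENNReal.rpow_le_rpow ?_ (by norm_num)
  calc N ^ (1 / γ) * powAvg I (fun x => w x ^ 2) (1 + ε) ^ (1 / (1 + ε))
      ≤ N ^ (1 / γ) * (C' * M ^ (1 + ε)) ^ (1 / (1 + ε)) := by gcongr
    _ = C' ^ (1 / (1 + ε)) * (M * N ^ (1 / γ)) := by
      rw [ENNReal.mul_rpow_of_nonneg _ _ hr0.le, ← ENNReal.rpow_mul,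
        mul_one_div_cancel (by positivity), ENNReal.rpow_one]
      ring
    _ ≤ _ := by gcongr

/-- The condition `α_q` passes, with exponent `t * q`, to `w ^ t * a ^ (1 - t)` for `t` close
to `1`. -/
theorem AlphaCondition.exists_rpow_mul_rpow {q : ℝ} (hq1 : 1 < q) (hq2 : q < 2)
    {w a : UnitAddCircle → ℝ} (hw : AlphaCondition q w) (ha : MuckenhouptAInfty a) :
    ∃ δ : ℝ, 0 < δ ∧ δ < 1 ∧ ∀ t ∈ Ico (1 - δ) 1, t * q ∈ Ioo (1 : ℝ) 2 ∧
      AlphaCondition (t * q) (fun x => w x ^ t * a x ^ (1 - t)) := by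
  obtain ⟨haw, s, hs, K₂, hK₂, hA⟩ := ha.exists_powAvg_mul_le
  obtain ⟨hww, K₁, hK₁, hW⟩ := (alphaCondition_iff hq1 hq2).1 hw
  have hq1' : 0 < q - 1 := by linarith
  have hq2' : 0 < 2 - q := by linarith
  have hσ : ∀ (I : Set UnitAddCircle) (m n : ℝ), -(1 / (q - 1)) * m = n →
      powAvg I (fun x => w x ^ (-(1 / (q - 1)))) m = powAvg I w n := fun I m n hmn =>
    powAvg_congr (by
      filter_upwards [hww.2] with x hx
      rw [← Real.rpow_mul hx.le, hmn])
  -- With this `s`, `σ ^ (-s) = w ^ (2 / (2 - q))`, and the Muckenhoupt product of `σ = w ^ (-(1 /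
  -- (q - 1)))` is the `α_q` product to the power `1 / (q - 1)`.
  obtain ⟨ε, hε, C, hC, hRH⟩ := exists_reverse_holder (hww.rpow (-(1 / (q - 1))))
    (s := 2 * (q - 1) / (2 - q)) (by positivity)
    (K := K₁ ^ (1 / (q - 1))) (ENNReal.rpow_ne_top_of_nonneg (by positivity) hK₁) (by
      intro I hI
      rw [hσ I 1 _ (mul_one _), hσ I (-(2 * (q - 1) / (2 - q))) (2 / (2 - q)) (by field_simp)]
      refine le_trans (le_of_eq ?_) (ENNReal.rpow_le_rpow (hW I hI) (by positivity))
      rw [ENNReal.mul_rpow_of_nonneg _ _ (by positivity), ← ENNReal.rpow_mul, ← ENNReal.rpow_mul,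
        mul_one_div_cancel hq1'.ne', ENNReal.rpow_one]
      congr 2
      field_simp)
  -- The bound on `1 - t` is found from `(1 - t) * (s + q) ≤ (q - 1) * ε / (1 + ε)`. It gives both
  -- `t * q > 1` and the Hölder exponent inequality `hsum`.
  have hη0 : 0 < (q - 1) * ε / ((1 + ε) * (s + q)) := by positivity
  refine ⟨min (1 / 2) ((q - 1) * ε / ((1 + ε) * (s + q))), lt_min (by norm_num) hη0,
    (min_le_left _ _).trans_lt (by norm_num), ?_⟩
  rintro t ⟨ht, ht1⟩
  have ht2 : 1 / 2 ≤ t := by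
    have := min_le_left (1 / 2) ((q - 1) * ε / ((1 + ε) * (s + q))); linarith
  have ht0 : 0 < t := by linarith
  have hτ : (1 - t) * (s + q) ≤ (q - 1) - (q - 1) / (1 + ε) := by
    have h1 : 1 - t ≤ (q - 1) * ε / ((1 + ε) * (s + q)) := by
      have := min_le_right (1 / 2) ((q - 1) * ε / ((1 + ε) * (s + q))); linarith
    calc (1 - t) * (s + q) ≤ (q - 1) * ε / ((1 + ε) * (s + q)) * (s + q) := by
          gcongr
      _ = _ := by field_simp; ring
  have hqε : 0 < (q - 1) / (1 + ε) := by positivity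
  have h1t : 0 < 1 - t := by linarith
  have htq1 : 0 < t * q - 1 := by nlinarith
  have htq2 : 0 < 2 - t * q := by nlinarith
  have hsum : t * (q - 1) / (1 + ε) + (1 - t) * (s - 1) ≤ t * q - 1 := by
    have : t * (q - 1) / (1 + ε) ≤ (q - 1) / (1 + ε) := by
      rw [mul_div_assoc]; exact mul_le_of_le_one_left hqε.le ht1.le
    nlinarith
  have hs' : 0 < s - 1 := by linarith
  refine ⟨⟨by linarith, by linarith⟩, (alphaCondition_iff (by linarith) (by linarith)).2
    ⟨(hww.rpow t).mul (haw.rpow (1 - t)),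
      C ^ (t * (q - 1) / (1 + ε)) * (K₁ ^ t * K₂ ^ (1 - t)), ?_, fun I hI => ?_⟩⟩
  · exact ENNReal.mul_ne_top (ENNReal.rpow_ne_top_of_nonneg (by positivity) hC)
      (ENNReal.mul_ne_top (ENNReal.rpow_ne_top_of_nonneg ht0.le hK₁)
        (ENNReal.rpow_ne_top_of_nonneg h1t.le hK₂))
  -- The power of `w` is raised to the reverse Hölder exponent of `σ`; the exponents add up to at
  -- most 1 by `hsum`.
  have hX := powAvg_rpow_mul_rpow_le hI hww haw (t := t) (e := -(1 / (t * q - 1)))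
    (m := -(1 / (q - 1)) * (1 + ε)) (n := -(1 / (s - 1)))
    (α := t * (q - 1) / (1 + ε) / (t * q - 1)) (β := (1 - t) * (s - 1) / (t * q - 1))
    (by positivity) (by positivity) (by rw [← add_div, div_le_one htq1]; exact hsum)
    (by field_simp) (by field_simp)
  -- Here the exponents add up to exactly 1, because `t * (2 - q) + 2 * (1 - t) = 2 - t * q`.
  have hY := powAvg_rpow_mul_rpow_le hI hww haw (t := t) (e := 2 / (2 - t * q))
    (m := 2 / (2 - q)) (n := 1)
    (α := t * (2 - q) / (2 - t * q)) (β := 2 * (1 - t) / (2 - t * q))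
    (by positivity) (by positivity) (le_of_eq (by field_simp; ring))
    (by field_simp) (by field_simp)
  have hR := hRH I hI
  rw [hσ I (1 + ε) _ rfl, hσ I 1 _ (mul_one _)] at hR
  have hW' := hW I hI
  have hA' := hA I hI
  set S := powAvg I w (-(1 / (q - 1)))
  set V := powAvg I w (2 / (2 - q))
  set A := powAvg I a 1
  set B := powAvg I a (-(1 / (s - 1)))
  set R := powAvg I w (-(1 / (q - 1)) * (1 + ε))
  set X := powAvg I (fun x => w x ^ t * a x ^ (1 - t)) (-(1 / (t * q - 1)))
  set Y := powAvg I (fun x => w x ^ t * a x ^ (1 - t)) (2 / (2 - t * q))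
  have hX' : X ^ (t * q - 1) ≤
      C ^ (t * (q - 1) / (1 + ε)) * S ^ (t * (q - 1)) * B ^ ((1 - t) * (s - 1)) := by
    calc X ^ (t * q - 1) ≤ (R ^ (t * (q - 1) / (1 + ε) / (t * q - 1)) *
          B ^ ((1 - t) * (s - 1) / (t * q - 1))) ^ (t * q - 1) := by gcongr
      _ = R ^ (t * (q - 1) / (1 + ε)) * B ^ ((1 - t) * (s - 1)) := by
        rw [ENNReal.mul_rpow_of_nonneg _ _ htq1.le, ← ENNReal.rpow_mul, ← ENNReal.rpow_mul,
          div_mul_cancel₀ _ htq1.ne', div_mul_cancel₀ _ htq1.ne']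
      _ ≤ (C * S ^ (1 + ε)) ^ (t * (q - 1) / (1 + ε)) * B ^ ((1 - t) * (s - 1)) := by gcongr
      _ = _ := by
        rw [ENNReal.mul_rpow_of_nonneg _ _ (by positivity), ← ENNReal.rpow_mul,
          mul_div_cancel₀ _ (by positivity)]
  have hY' : Y ^ ((2 - t * q) / 2) ≤ V ^ (t * ((2 - q) / 2)) * A ^ (1 - t) := by
    calc Y ^ ((2 - t * q) / 2) ≤ (V ^ (t * (2 - q) / (2 - t * q)) *
          A ^ (2 * (1 - t) / (2 - t * q))) ^ ((2 - t * q) / 2) := by gcongr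
      _ = _ := by
        rw [ENNReal.mul_rpow_of_nonneg _ _ (by positivity), ← ENNReal.rpow_mul, ← ENNReal.rpow_mul]
        congr 2 <;> field_simp
  calc X ^ (t * q - 1) * Y ^ ((2 - t * q) / 2)
      ≤ (C ^ (t * (q - 1) / (1 + ε)) * S ^ (t * (q - 1)) * B ^ ((1 - t) * (s - 1))) *
        (V ^ (t * ((2 - q) / 2)) * A ^ (1 - t)) := by gcongr
    _ = C ^ (t * (q - 1) / (1 + ε)) * ((S ^ (q - 1) * V ^ ((2 - q) / 2)) ^ t *
        (A * B ^ (s - 1)) ^ (1 - t)) := by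
      rw [ENNReal.mul_rpow_of_nonneg _ _ ht0.le, ENNReal.mul_rpow_of_nonneg _ _ h1t.le,
        ← ENNReal.rpow_mul, ← ENNReal.rpow_mul, ← ENNReal.rpow_mul, mul_comm t (q - 1),
        mul_comm t ((2 - q) / 2), mul_comm (1 - t) (s - 1)]
      ring
    _ ≤ _ := by gcongr

theorem lemma1 (q : ℝ) (hq1 : 1 ≤ q) (hq2 : q < 2) (w a : UnitAddCircle → ℝ)
    (hw : AlphaCondition q w) (ha : MuckenhouptAInfty a) :
    ∃ δ : ℝ, 0 < δ ∧ δ < 1 ∧ ∀ t ∈ Ico (1 - δ) 1,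
      (∃ r ∈ Ioo (1 : ℝ) 2, AlphaCondition r (fun x => w x ^ t * a x ^ (1 - t))) ∧
      (1 < q → t * q ∈ Ioo (1 : ℝ) 2 ∧
        AlphaCondition (t * q) (fun x => w x ^ t * a x ^ (1 - t))) := by
  rcases hq1.eq_or_lt with rfl | hq1
  · obtain ⟨r, hr, hwr⟩ := hw.exists_one_lt
    obtain ⟨δ, h0, h1, h⟩ := hwr.exists_rpow_mul_rpow hr.1 hr.2 ha
    exact ⟨δ, h0, h1, fun t ht => ⟨⟨t * r, h t ht⟩, fun h => absurd h (lt_irrefl _)⟩⟩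
  · obtain ⟨δ, h0, h1, h⟩ := hw.exists_rpow_mul_rpow hq1 hq2 ha
    exact ⟨δ, h0, h1, fun t ht => ⟨⟨t * q, h t ht⟩, fun _ => h t ht⟩⟩
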